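/- Let $\xi$ be a random variable with values in a measurable space $\Xi$, let $F:\mathbb R^n\times\Xi\to\mathbb R$ be measurable in its second argument, and let $\xi_1,\xi_2,\dots$ be an i.i.d. sequence with the distribution of $\xi$. Put $f(y)=\mathbb E\,F(y,\xi)$ and $f_i(y)=F(y,\xi_i)$. For a nonempty finite $S\subset\mathbb N$ put $f_S=\frac1{|S|}\sum_{i\in S}f_i$, $\nabla f_S=\frac1{|S|}\sum_{i\in S}\nabla f_i$, $\nabla^2f_S=\frac1{|S|}\sum_{i\in S}\nabla^2f_i$. Let $\|\cdot\|$ be the Euclidean norm. **GIN sequences.** Let $c,\bar\eta\in(0,1)$ and let $\nu_k>0$ be a deterministic sequence with $\sum_k\nu_k<\infty$. Random vectors $x^0,x^1,\dots$ in $\mathbb R^n$ are generated by GIN with the random nonempty finite samples $\mathcal N_k\subset\mathbb N$ if, almost surely, for every $k$ there are a nonempty finite set $\mathcal D_k\subset\mathbb N$, a number $\eta_k\in(0,\bar\eta)$ and a vector $s^k$ such that * $s^k$ is some iterate of the conjugate gradient method, initialized with the null vector, for the system $\nabla^2f_{\mathcal D_k}(x^k)\,s=-\nabla f_{\mathcal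 N_k}(x^k)$, and $\|\nabla^2f_{\mathcal D_k}(x^k)s^k+\nabla f_{\mathcal N_k}(x^k)\|\le\eta_k\|\nabla f_{\mathcal N_k}(x^k)\|$; * $x^{k+1}=x^k+t_ks^k$, where $t_k=2^{-j}$ with the smallest integer $j\ge0$ for which $f_{\mathcal N_k}(x^k+t_ks^k)\le f_{\mathcal N_k}(x^k)+c\,t_k\,(s^k)^T\nabla f_{\mathcal N_k}(x^k)+\nu_k$. The choice of $\mathcal D_k$, $\eta_k$ and of the number of conjugate gradient iterations is otherwise arbitrary. The samples $\mathcal N_k$ are selected without bias: for each $k$, either for every finite $T\subset\mathbb N$ the event $\{\mathcal N_k=T\}$ is independent of $(\xi_i)_{i\in T}$ (in particular, $\mathcal N_k$ may be deterministic, or independent of the data), or almost surely $\mathcal N_k=\{1,\dots,N_k\}$, where $N_k$ may depend on the data in any way. Write $N_k=|\mathcal N_k|$. **Theorem.** Assume: * (A1) there are constants $\lambda_1>0$ and $\lambda_n$ such that almost surely $\lambda_1I\preceq\nabla^2f_i(y)\preceq\lambda_nI$ for all $i$ and all $y\in\mathbb R^n$; * (B2) there is a (deterministic) compact set $K\subset\mathbb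 R^n$ such that almost surely $x^k\in K$ for all $k$; * (B3) $F(\cdot,z)\in C^2(\mathbb R^n)$ for every $z\in\Xi$, and there are an open set $U\supseteq K$ and functions $M_f,M_g$ on $\Xi$ with $M_f(\xi),M_g(\xi)$ integrable such that almost surely $|F(y,\xi)|\le M_f(\xi)$ and $\|\nabla_yF(y,\xi)\|\le M_g(\xi)$ for all $y\in U$; * $N_k\to\infty$ almost surely. Then $F(y,\xi)$ is integrable for every $y\in\mathbb R^n$, the function $f$ has a unique minimizer $x^*$ on $\mathbb R^n$, each $x^k-x^*$ is square integrable, and $$\lim_{k\to\infty}\mathbb E\,\|x^k-x^*\|^2=0 .$$ -/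

import Mathlib

open MeasureTheory ProbabilityTheory Filter Topology

noncomputable section

namespace GIN

/-- The space of decision variables, with the 2-norm. -/
abbrev Vec (n : ℕ) : Type := EuclideanSpace ℝ (Fin n)

variable {n : ℕ}

/-- The Hessian of `g` at `x`, as a linear operator: the derivative of the gradient. -/
def hess (g : Vec n → ℝ) (x : Vec n) : Vec n →L[ℝ] Vec n :=
  fderiv ℝ (fun y => gradient g y) x

/-- The average of the family `a` over the finite index set `S`. -/
def avg {V : Type*} [AddCommGroup V] [Module ℝ V] (S : Finset ℕ) (a : ℕ → V) : V :=
  (S.card : ℝ)⁻¹ • ∑ i ∈ S, a i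

/-- Subsampled function. -/
def subFun (f : ℕ → Vec n → ℝ) (S : Finset ℕ) (x : Vec n) : ℝ :=
  avg S (fun i => f i x)

/-- Subsampled gradient. -/
def subGrad (f : ℕ → Vec n → ℝ) (S : Finset ℕ) (x : Vec n) : Vec n :=
  avg S (fun i => gradient (f i) x)

/-- Subsampled Hessian. -/
def subHess (f : ℕ → Vec n → ℝ) (D : Finset ℕ) (x : Vec n) : Vec n →L[ℝ] Vec n :=
  avg D (fun i => hess (f i) x)

/-- The state of the conjugate gradient method: iterate, residual, search direction. -/
structure CGState (n : ℕ) where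
  sol : Vec n
  res : Vec n
  dir : Vec n

/-- The step length `⟨r, r⟩ / ⟨p, A p⟩` of the conjugate gradient method.
(It is `0 / 0 = 0` once the residual vanishes, so the iterates then stay at the solution.) -/
def cgAlpha (A : Vec n →L[ℝ] Vec n) (σ : CGState n) : ℝ :=
  inner ℝ σ.res σ.res / inner ℝ σ.dir (A σ.dir)

/-- The residual after one more conjugate gradient iteration. -/
def cgRes (A : Vec n →L[ℝ] Vec n) (σ : CGState n) : Vec n :=
  σ.res - cgAlpha A σ • A σ.dir

/-- One iteration of the conjugate gradient method. -/
def cgStep (A : Vec n →L[ℝ] Vec n) (σ : CGState n) : CGState n where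
  sol := σ.sol + cgAlpha A σ • σ.dir
  res := cgRes A σ
  dir := cgRes A σ +
    (inner ℝ (cgRes A σ) (cgRes A σ) / inner ℝ σ.res σ.res : ℝ) • σ.dir

/-- The states of the conjugate gradient method for `A s = b`, initialized with the null vector. -/
def cgState (A : Vec n →L[ℝ] Vec n) (b : Vec n) : ℕ → CGState n
  | 0 => ⟨0, b, b⟩
  | i + 1 => cgStep A (cgState A b i)

/-- The `i`-th conjugate gradient iterate for `A s = b`, initialized with the null vector. -/
def cgIterate (A : Vec n →L[ℝ] Vec n) (b : Vec n) (i : ℕ) : Vec n :=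
  (cgState A b i).sol

/-- The nonmonotone line search condition with step length `t`. -/
def LineSearch (f : ℕ → Vec n → ℝ) (S : Finset ℕ) (c ν : ℝ) (x s : Vec n) (t : ℝ) : Prop :=
  subFun f S (x + t • s) ≤ subFun f S x + c * t * inner ℝ s (subGrad f S x) + ν

/-- `x'` can be produced from `x` by one iteration of Algorithm GIN for the functions `f i`, with
sample `S` for the function and the gradient. The Hessian sample `D`, the forcing term `η` and the
number `i` of inner iterations are arbitrary, as long as the step `s` satisfies the inexact Newton
condition. The step length is `2 ^ (-j)` with the smallest `j` passing the line search. -/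
def IsStep (f : ℕ → Vec n → ℝ) (c ηbar ν : ℝ) (S : Finset ℕ) (x x' : Vec n) : Prop :=
  ∃ D : Finset ℕ, D.Nonempty ∧ ∃ η : ℝ, 0 < η ∧ η < ηbar ∧ ∃ s : Vec n,
    (∃ i : ℕ, s = cgIterate (subHess f D x) (-subGrad f S x) i) ∧
    ‖subHess f D x s + subGrad f S x‖ ≤ η * ‖subGrad f S x‖ ∧
    ∃ j : ℕ, IsLeast {j : ℕ | LineSearch f S c ν x s ((1 / 2 : ℝ) ^ j)} j ∧
      x' = x + ((1 / 2 : ℝ) ^ j) • s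

/-- `x` is a sequence generated by Algorithm GIN with the function and gradient samples `S k`. -/
def IsSequence (f : ℕ → Vec n → ℝ) (c ηbar : ℝ) (ν : ℕ → ℝ) (S : ℕ → Finset ℕ)
    (x : ℕ → Vec n) : Prop :=
  ∀ k, (S k).Nonempty ∧ IsStep f c ηbar (ν k) (S k) (x k) (x (k + 1))

/-- A random finite index set `S` is selected without bias from the data `ζ 0, ζ 1, …`: either the
event that `S` is a given set `T` is always independent of the data with index in `T` (for example
`S` is deterministic, or random and independent of the data, or a batch of fresh data whose size is
chosen from earlier data), or `S` consists of the first data, in a number that may depend on the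
data in an arbitrary way. -/
def Unbiased {Ω Ξ : Type*} [MeasurableSpace Ω] [MeasurableSpace Ξ] (P : Measure Ω)
    (ζ : ℕ → Ω → Ξ) (S : Ω → Finset ℕ) : Prop :=
  (∀ T : Finset ℕ, IndepFun (fun ω => S ω = T) (fun ω (i : T) => ζ i ω) P) ∨
  (∀ᵐ ω ∂P, ∃ m : ℕ, S ω = Finset.range m)

end GIN

end

/-! ### Quadratic sandwich bounds: Taylor's formula, averages, minimizers. -/

namespace GIN

variable {n : ℕ}

/-! The Hessian bounds enter mainly through `QuadBounds`, a sandwich between two quadratics that is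
linear in the pair of function and gradient. It therefore passes to sample averages and to
expectations, with no differentiation under the integral, and makes `f` strongly convex with
minimizer `z`.

One GIN step contracts the gap of the subsampled function relative to any reference point by a fixed
factor `1 - θ`, up to `ν k` (`IsStep.contraction`). Indeed a conjugate gradient step is a
gradient-related descent direction and the line search cannot return a step length below a fixed
constant. Replacing the subsampled function by `f` at the old iterate, the new iterate and `z` costs
at most four times its uniform deviation on `K ∪ {z}`. By `exists_uniform_dev_le` this deviation is
controlled by those of finitely many scalar averages.

Such averages need not converge almost surely along arbitrary samples, so the argument runs in
expectation. The gap is bounded on `K`, hence the deviations may be truncated. Independence lets a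
sample be replaced by an initial segment of the same size, and the strong law with dominated
convergence finishes `tendsto_integral_sampleDev`. The expected gap then satisfies a contractive
recursion with vanishing error, and strong convexity turns the gap into squared distance. -/

/-- `g` lies between the quadratic models at `x` with linear term `G x` and curvatures `m`, `L`,
for every `x`. -/
def QuadBounds (m L : ℝ) (g : Vec n → ℝ) (G : Vec n → Vec n) : Prop :=
  ∀ x y, g x + inner ℝ (G x) (y - x) + m / 2 * ‖y - x‖ ^ 2 ≤ g y ∧
    g y ≤ g x + inner ℝ (G x) (y - x) + L / 2 * ‖y - x‖ ^ 2

/-- Two monotonicity arguments replace a remainder formula, so `φ''` need not be continuous. The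
matching upper bound follows by applying this to `-φ`. -/
theorem taylor_lower {φ φ' φ'' : ℝ → ℝ} {m : ℝ} (h1 : ∀ t, HasDerivAt φ (φ' t) t)
    (h2 : ∀ t, HasDerivAt φ' (φ'' t) t) (hm : ∀ t, m ≤ φ'' t) :
    φ 0 + φ' 0 + m / 2 ≤ φ 1 := by
  have d2 : ∀ t, HasDerivAt (fun t => φ' t - m * t) (φ'' t - m * 1) t := fun t =>
    (h2 t).sub ((hasDerivAt_id t).const_mul m)
  have mono2 : Monotone (fun t => φ' t - m * t) :=
    monotone_of_hasDerivAt_nonneg d2 (fun t => by simpa using hm t)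
  have d1 : ∀ t, HasDerivAt (fun t => φ t - φ' 0 * t - m / 2 * t ^ 2)
      (φ' t - φ' 0 * 1 - m / 2 * (2 * t)) t := fun t => by
    refine HasDerivAt.congr_deriv (((h1 t).sub ((hasDerivAt_id t).const_mul (φ' 0))).sub
      ((hasDerivAt_pow 2 t).const_mul (m / 2))) ?_
    simp
  have mono1 : MonotoneOn (fun t => φ t - φ' 0 * t - m / 2 * t ^ 2) (Set.Icc 0 1) := by
    apply monotoneOn_of_deriv_nonneg (convex_Icc 0 1)
      (fun t _ => (d1 t).continuousAt.continuousWithinAt)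
      (fun t _ => (d1 t).differentiableAt.differentiableWithinAt)
    intro t ht
    rw [interior_Icc] at ht
    rw [(d1 t).deriv]
    have := mono2 ht.1.le
    simp only at this
    linarith
  have := mono1 (by simp) (by simp) (zero_le_one' ℝ)
  simp only at this
  linarith

theorem hasGradientAt_of_contDiff {g : Vec n → ℝ} (hg : ContDiff ℝ 2 g) (x : Vec n) :
    HasGradientAt g (gradient g x) x :=
  (hg.differentiable (by norm_num) x).hasGradientAt

theorem differentiable_gradient {g : Vec n → ℝ} (hg : ContDiff ℝ 2 g) :
    Differentiable ℝ (fun y => gradient g y) := by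
  have h : ContDiff ℝ 1 (fderiv ℝ g) := hg.fderiv_right (by norm_num)
  exact (InnerProductSpace.toDual ℝ (Vec n)).symm.toContinuousLinearEquiv.differentiable.comp
    (h.differentiable (by norm_num))

theorem inner_hess {g : Vec n → ℝ} (hg : ContDiff ℝ 2 g) (x v w : Vec n) :
    inner ℝ (hess g x v) w = fderiv ℝ (fderiv ℝ g) x v w := by
  have h : ContDiff ℝ 1 (fderiv ℝ g) := hg.fderiv_right (by norm_num)
  have h1 : HasFDerivAt (fun y => inner ℝ w (gradient g y)) ((innerSL ℝ w).comp (hess g x)) x :=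
    (innerSL ℝ w).hasFDerivAt.comp x (differentiable_gradient hg x).hasFDerivAt
  have h2 : HasFDerivAt (fun y => inner ℝ w (gradient g y))
      ((ContinuousLinearMap.apply ℝ ℝ w).comp (fderiv ℝ (fderiv ℝ g) x)) x := by
    have : (fun y => inner ℝ w (gradient g y)) = fun y => fderiv ℝ g y w := by
      funext y
      rw [real_inner_comm]
      exact InnerProductSpace.toDual_symm_apply
    rw [this]
    exact (ContinuousLinearMap.apply ℝ ℝ w).hasFDerivAt.comp x
      (h.differentiable (by norm_num) x).hasFDerivAt
  rw [real_inner_comm]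
  exact DFunLike.congr_fun (h1.unique h2) v

/-- Symmetry of the second Fréchet derivative, carried through the Riesz isomorphism; the conjugate
gradient energy identity needs it. -/
theorem hess_symm {g : Vec n → ℝ} (hg : ContDiff ℝ 2 g) (x v w : Vec n) :
    inner ℝ (hess g x v) w = inner ℝ v (hess g x w) := by
  rw [real_inner_comm _ v, inner_hess hg, inner_hess hg]
  exact (hg.contDiffAt.isSymmSndFDerivAt (by simp)) v w

theorem quadBounds_of_hess {g : Vec n → ℝ} {m L : ℝ} (hg : ContDiff ℝ 2 g)
    (h : ∀ y v, m * ‖v‖ ^ 2 ≤ inner ℝ v (hess g y v) ∧ inner ℝ v (hess g y v) ≤ L * ‖v‖ ^ 2) :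
    QuadBounds m L g (fun y => gradient g y) := by
  intro x y
  set v := y - x with hv
  have hline : ∀ t : ℝ, HasDerivAt (fun t : ℝ => x + t • v) v t := fun t => by
    simpa using ((hasDerivAt_id t).smul_const v).const_add x
  have h1 : ∀ t : ℝ, HasDerivAt (fun t : ℝ => g (x + t • v))
      (inner ℝ (gradient g (x + t • v)) v) t := fun t => by
    exact (hasGradientAt_of_contDiff hg (x + t • v)).hasFDerivAt.comp_hasDerivAt t (hline t)
  have h2 : ∀ t : ℝ, HasDerivAt (fun t : ℝ => inner ℝ (gradient g (x + t • v)) v)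
      (inner ℝ (hess g (x + t • v) v) v) t := fun t => by
    have := (differentiable_gradient hg (x + t • v)).hasFDerivAt.comp_hasDerivAt t (hline t)
    refine (this.inner ℝ (hasDerivAt_const t v)).congr_deriv ?_
    simp [hess]
  have e : x + (1 : ℝ) • v = y := by simp [hv]
  constructor
  · have := taylor_lower h1 h2 (m := m * ‖v‖ ^ 2) (fun t => by
      rw [real_inner_comm]; exact (h _ v).1)
    simp only [e, zero_smul, add_zero] at this
    linarith
  · have := taylor_lower (fun t => (h1 t).neg) (fun t => (h2 t).neg) (m := -(L * ‖v‖ ^ 2))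
      (fun t => by rw [real_inner_comm]; exact neg_le_neg (h _ v).2)
    simp only [Pi.neg_apply, e, zero_smul, add_zero] at this
    linarith

theorem avg_const {V : Type*} [AddCommGroup V] [Module ℝ V] {S : Finset ℕ} (hS : S.Nonempty)
    (a : V) : avg S (fun _ => a) = a := by
  have : (S.card : ℝ) ≠ 0 := by exact_mod_cast hS.card_pos.ne'
  rw [avg, Finset.sum_const, ← Nat.cast_smul_eq_nsmul ℝ, smul_smul, inv_mul_cancel₀ this, one_smul]

theorem avg_add {V : Type*} [AddCommGroup V] [Module ℝ V] (S : Finset ℕ)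
    (a b : ℕ → V) : avg S (fun i => a i + b i) = avg S a + avg S b := by
  simp [avg, Finset.sum_add_distrib]

theorem avg_mono {S : Finset ℕ} {a b : ℕ → ℝ} (h : ∀ i, a i ≤ b i) : avg S a ≤ avg S b := by
  simp only [avg, smul_eq_mul]
  exact mul_le_mul_of_nonneg_left (Finset.sum_le_sum fun i _ => h i) (by positivity)

theorem map_avg {V W : Type*} [AddCommGroup V] [Module ℝ V] [AddCommGroup W] [Module ℝ W]
    (S : Finset ℕ) (a : ℕ → V) (l : V →ₗ[ℝ] W) : l (avg S a) = avg S (fun i => l (a i)) := by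
  simp [avg]

theorem inner_avg_left (S : Finset ℕ) (a : ℕ → Vec n) (v : Vec n) :
    inner ℝ (avg S a) v = avg S (fun i => (inner ℝ (a i) v : ℝ)) := by
  simpa [innerₗ_apply_apply, real_inner_comm] using map_avg S a (innerₗ (Vec n) v)

theorem avg_apply (S : Finset ℕ) (a : ℕ → Vec n →L[ℝ] Vec n) (v : Vec n) :
    avg S a v = avg S (fun i => a i v) := by
  simp [avg]

theorem norm_avg_le (S : Finset ℕ) (a : ℕ → Vec n) : ‖avg S a‖ ≤ avg S (fun i => ‖a i‖) := by
  simp only [avg, norm_smul, smul_eq_mul, norm_inv, RCLike.norm_natCast]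
  exact mul_le_mul_of_nonneg_left (norm_sum_le _ _) (by positivity)

theorem QuadBounds.avg {m L : ℝ} {g : ℕ → Vec n → ℝ} {G : ℕ → Vec n → Vec n} {S : Finset ℕ}
    (hS : S.Nonempty) (h : ∀ i, QuadBounds m L (g i) (G i)) :
    QuadBounds m L (fun y => avg S (fun i => g i y)) (fun y => GIN.avg S (fun i => G i y)) := by
  intro x y
  rw [inner_avg_left]
  have key : ∀ d : ℝ, GIN.avg S (fun i => g i x + inner ℝ (G i x) (y - x) + d) =
      GIN.avg S (fun i => g i x) + GIN.avg S (fun i => (inner ℝ (G i x) (y - x) : ℝ)) + d := by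
    intro d
    rw [avg_add, avg_add, avg_const hS]
  rw [← key, ← key]
  exact ⟨avg_mono fun i => (h i x y).1, avg_mono fun i => (h i x y).2⟩

theorem QuadBounds.abs_sub_le {m L : ℝ} (hm : 0 ≤ m) (hL : 0 ≤ L) {g : Vec n → ℝ}
    {G : Vec n → Vec n} (h : QuadBounds m L g G) (x y : Vec n) :
    |g y - g x| ≤ ‖G x‖ * ‖y - x‖ + L / 2 * ‖y - x‖ ^ 2 := by
  have h1 := h x y
  have h2 := abs_le.1 (abs_real_inner_le_norm (G x) (y - x))
  have h3 : 0 ≤ m / 2 * ‖y - x‖ ^ 2 := by positivity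
  have h4 : 0 ≤ L / 2 * ‖y - x‖ ^ 2 := by positivity
  rw [abs_le]
  constructor <;> linarith [h1.1, h1.2, h2.1, h2.2]

theorem QuadBounds.continuous {m L : ℝ} (hm : 0 ≤ m) (hL : 0 ≤ L) {g : Vec n → ℝ}
    {G : Vec n → Vec n} (h : QuadBounds m L g G) : Continuous g := by
  rw [continuous_iff_continuousAt]
  intro x
  rw [ContinuousAt, tendsto_iff_dist_tendsto_zero]
  have hlim : Tendsto (fun y => ‖G x‖ * ‖y - x‖ + L / 2 * ‖y - x‖ ^ 2) (𝓝 x) (𝓝 0) := by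
    have : Continuous (fun y => ‖G x‖ * ‖y - x‖ + L / 2 * ‖y - x‖ ^ 2) := by fun_prop
    simpa using this.tendsto x
  exact squeeze_zero (fun _ => dist_nonneg) (fun y => h.abs_sub_le hm hL x y) hlim

theorem QuadBounds.exists_min {m L : ℝ} (hm : 0 < m) (hL : 0 < L) {g : Vec n → ℝ}
    {G : Vec n → Vec n} (h : QuadBounds m L g G) :
    ∃ x, ∀ y, g x + m / 2 * ‖y - x‖ ^ 2 ≤ g y := by
  have hco : Tendsto g (cocompact (Vec n)) atTop := by
    have h1 : Tendsto (fun r : ℝ => g 0 + r * (m / 2 * r + -‖G 0‖)) atTop atTop :=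
      tendsto_atTop_add_const_left _ _ (tendsto_id.atTop_mul_atTop₀
        (tendsto_atTop_add_const_right _ _ (tendsto_id.const_mul_atTop (by positivity))))
    refine tendsto_atTop_mono (fun y => ?_) (h1.comp (tendsto_norm_cocompact_atTop (E := Vec n)))
    have h2 := abs_le.1 (abs_real_inner_le_norm (G 0) (y - 0))
    have h3 := (h 0 y).1
    simp only [sub_zero, Function.comp] at h2 h3 ⊢
    nlinarith [h2.1]
  obtain ⟨x, hx⟩ := (h.continuous hm.le hL.le).exists_forall_le hco
  -- `G` is not assumed to be the gradient of `g`, so stationarity comes from the upper model: the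
  -- step `-L⁻¹ • G x` would otherwise decrease `g`.
  have hG : G x = 0 := by
    have h1 := (h x (x - L⁻¹ • G x)).2.trans' (hx _)
    have h2 : x - L⁻¹ • G x - x = -(L⁻¹ • G x) := by abel
    rw [h2, norm_neg, norm_smul, inner_neg_right, inner_smul_right, real_inner_self_eq_norm_sq,
      Real.norm_of_nonneg (by positivity)] at h1
    have h3 : L / 2 * (L⁻¹ * ‖G x‖) ^ 2 = L⁻¹ * ‖G x‖ ^ 2 / 2 := by field_simp
    have h4 : L⁻¹ * ‖G x‖ ^ 2 ≤ 0 := by linarith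
    have h5 : ‖G x‖ ^ 2 ≤ 0 := nonpos_of_mul_nonpos_right h4 (by positivity)
    exact norm_eq_zero.1 (pow_eq_zero_iff two_ne_zero |>.1 (le_antisymm h5 (by positivity)))
  refine ⟨x, fun y => ?_⟩
  simpa [hG] using (h x y).1

/-- The Polyak–Łojasiewicz inequality: complete the square in the lower model. The point `y` need
not be a minimizer. -/
theorem QuadBounds.sub_le_norm_sq {m L : ℝ} (hm : 0 < m) {g : Vec n → ℝ}
    {G : Vec n → Vec n} (h : QuadBounds m L g G) (x y : Vec n) :
    2 * m * (g x - g y) ≤ ‖G x‖ ^ 2 := by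
  have h1 := (h x y).1
  have h2 := abs_le.1 (abs_real_inner_le_norm (G x) (y - x))
  nlinarith [sq_nonneg (m * ‖y - x‖ - ‖G x‖), h2.1]

end GIN

/-! ### Conjugate gradient descent and contraction of one GIN step. -/

namespace GIN

variable {n : ℕ}

/-- The invariants of the conjugate gradient method that the descent estimate needs. -/
structure CGInv (A : Vec n →L[ℝ] Vec n) (b : Vec n) (σ : CGState n) : Prop where
  res_eq : σ.res = b - A σ.sol
  inner_eq : inner ℝ σ.dir σ.res = (inner ℝ σ.res σ.res : ℝ)

/-- The quadratic function minimized by the conjugate gradient method. -/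
noncomputable def quadModel (A : Vec n →L[ℝ] Vec n) (b s : Vec n) : ℝ := inner ℝ s (A s) / 2 - inner ℝ s b

/-- This also covers the step length `0 / 0 = 0`: a zero denominator forces a zero direction, and
then the invariant forces a zero residual. -/
theorem alpha_mul {A : Vec n →L[ℝ] Vec n} {m : ℝ} (hm : 0 < m)
    (hA : ∀ v, m * ‖v‖ ^ 2 ≤ inner ℝ v (A v)) {b : Vec n} {σ : CGState n} (h : CGInv A b σ) :
    cgAlpha A σ * inner ℝ σ.dir (A σ.dir) = inner ℝ σ.res σ.res := by
  by_cases h0 : (inner ℝ σ.dir (A σ.dir) : ℝ) = 0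
  · have h1 := hA σ.dir
    rw [h0] at h1
    have h2 : σ.dir = 0 := by
      have : ‖σ.dir‖ ^ 2 ≤ 0 := nonpos_of_mul_nonpos_right h1 hm
      exact norm_eq_zero.1 (pow_eq_zero_iff two_ne_zero |>.1 (le_antisymm this (by positivity)))
    rw [← h.inner_eq, h2]
    simp
  · rw [cgAlpha, div_mul_cancel₀ _ h0]

theorem cgInv_cgState {A : Vec n →L[ℝ] Vec n} {m : ℝ} (hm : 0 < m)
    (hA : ∀ v, m * ‖v‖ ^ 2 ≤ inner ℝ v (A v)) (b : Vec n) (i : ℕ) : CGInv A b (cgState A b i) := by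
  induction i with
  | zero => exact ⟨by simp [cgState], by simp [cgState]⟩
  | succ i ih =>
    set σ := cgState A b i
    have horth : inner ℝ σ.dir (cgRes A σ) = (0 : ℝ) := by
      rw [cgRes, inner_sub_right, inner_smul_right, alpha_mul hm hA ih, ih.inner_eq, sub_self]
    refine ⟨?_, ?_⟩
    · change cgRes A σ = b - A (σ.sol + cgAlpha A σ • σ.dir)
      rw [cgRes, ih.res_eq, map_add, map_smul]
      abel
    · change inner ℝ (cgRes A σ + _ • σ.dir) (cgRes A σ) = inner ℝ (cgRes A σ) (cgRes A σ)
      rw [inner_add_left, inner_smul_left, horth]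
      simp

/-- Each iteration is an exact line minimization. Only the identity between direction and residual
in `CGInv` is needed, not conjugacy of the directions. -/
theorem quadModel_succ {A : Vec n →L[ℝ] Vec n} {m : ℝ} (hm : 0 < m)
    (hA : ∀ v, m * ‖v‖ ^ 2 ≤ inner ℝ v (A v))
    (hsymm : ∀ v w, inner ℝ (A v) w = (inner ℝ v (A w) : ℝ)) (b : Vec n) (i : ℕ) :
    quadModel A b (cgIterate A b (i + 1)) = quadModel A b (cgIterate A b i) -
      cgAlpha A (cgState A b i) * inner ℝ (cgState A b i).res (cgState A b i).res / 2 := by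
  have ih := cgInv_cgState hm hA b i
  change quadModel A b ((cgState A b i).sol + cgAlpha A (cgState A b i) • (cgState A b i).dir) =
    quadModel A b (cgState A b i).sol - _
  set σ := cgState A b i
  set α := cgAlpha A σ with hα
  have h1 : α * inner ℝ σ.dir (A σ.dir) = inner ℝ σ.res σ.res := alpha_mul hm hA ih
  have h2 : inner ℝ σ.dir (A σ.sol) = inner ℝ σ.dir b - (inner ℝ σ.res σ.res : ℝ) := by
    rw [← ih.inner_eq, ih.res_eq, inner_sub_right]; ring
  have h3 : inner ℝ σ.sol (A σ.dir) = (inner ℝ σ.dir (A σ.sol) : ℝ) := by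
    rw [← hsymm, real_inner_comm]
  simp only [quadModel, map_add, map_smul, inner_add_left, inner_add_right, inner_smul_left,
    inner_smul_right, h3, h2, RCLike.conj_to_real]
  linear_combination (α / 2) * h1

theorem quadModel_antitone {A : Vec n →L[ℝ] Vec n} {m : ℝ} (hm : 0 < m)
    (hA : ∀ v, m * ‖v‖ ^ 2 ≤ inner ℝ v (A v))
    (hsymm : ∀ v w, inner ℝ (A v) w = (inner ℝ v (A w) : ℝ)) (b : Vec n) :
    Antitone fun i => quadModel A b (cgIterate A b i) := by
  refine antitone_nat_of_succ_le fun i => ?_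
  rw [quadModel_succ hm hA hsymm]
  have h0 : 0 ≤ cgAlpha A (cgState A b i) :=
    div_nonneg real_inner_self_nonneg ((by positivity : 0 ≤ m * _).trans (hA _))
  have : 0 ≤ (inner ℝ (cgState A b i).res (cgState A b i).res : ℝ) := real_inner_self_nonneg
  have := mul_nonneg h0 this
  linarith

theorem quadModel_one_le {A : Vec n →L[ℝ] Vec n} {m L : ℝ} (hm : 0 < m) (hL : 0 < L)
    (hA : ∀ v, m * ‖v‖ ^ 2 ≤ inner ℝ v (A v)) (hA' : ∀ v, inner ℝ v (A v) ≤ L * ‖v‖ ^ 2)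
    (hsymm : ∀ v w, inner ℝ (A v) w = (inner ℝ v (A w) : ℝ)) (b : Vec n) :
    quadModel A b (cgIterate A b 1) ≤ -(‖b‖ ^ 2 / (2 * L)) := by
  refine (quadModel_succ hm hA hsymm b 0).trans_le ?_
  simp only [cgIterate, cgState, quadModel, cgAlpha, real_inner_self_eq_norm_sq, map_zero,
    inner_zero_left]
  by_cases hb : b = 0
  · simp [hb]
  have hb' : 0 < ‖b‖ := norm_pos_iff.2 hb
  have h1 : 0 < (inner ℝ b (A b) : ℝ) := (by positivity : 0 < m * ‖b‖ ^ 2).trans_le (hA b)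
  have h2 : L⁻¹ ≤ ‖b‖ ^ 2 / inner ℝ b (A b) := by
    rw [le_div_iff₀ h1, inv_mul_le_iff₀ hL]; exact hA' b
  have h3 := mul_le_mul_of_nonneg_right h2 (by positivity : 0 ≤ ‖b‖ ^ 2)
  have h4 : ‖b‖ ^ 2 / (2 * L) = L⁻¹ * ‖b‖ ^ 2 / 2 := by field_simp
  rw [h4]
  linarith

/-- A conjugate gradient iterate satisfying the inexact Newton condition is a gradient-related
descent direction. -/
theorem cgIterate_descent {A : Vec n →L[ℝ] Vec n} {m L : ℝ} (hm : 0 < m) (hL : 0 < L)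
    (hA : ∀ v, m * ‖v‖ ^ 2 ≤ inner ℝ v (A v)) (hA' : ∀ v, inner ℝ v (A v) ≤ L * ‖v‖ ^ 2)
    (hsymm : ∀ v w, inner ℝ (A v) w = (inner ℝ v (A w) : ℝ)) {b : Vec n} {i : ℕ} {η : ℝ}
    (hη : η < 1) (hres : ‖A (cgIterate A b i) - b‖ ≤ η * ‖b‖) :
    m / 2 * ‖cgIterate A b i‖ ^ 2 ≤ inner ℝ (cgIterate A b i) b ∧
      ‖b‖ ^ 2 / (2 * L) ≤ inner ℝ (cgIterate A b i) b := by
  have hs := hA (cgIterate A b i)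
  have hs0 : 0 ≤ m * ‖cgIterate A b i‖ ^ 2 := by positivity
  -- The inexact Newton condition matters only here: the null iterate passes it only if `b = 0`.
  -- Every later iterate is at least as good as the first, a steepest descent step.
  rcases Nat.eq_zero_or_pos i with rfl | hi
  · have hb : ‖b‖ = 0 := by
      simp only [cgIterate, cgState, map_zero, zero_sub, norm_neg] at hres
      nlinarith [norm_nonneg b]
    simp [cgIterate, cgState, hb]
  · have h1 := quadModel_antitone hm hA hsymm b hi
    have h2 := h1.trans (quadModel_one_le hm hL hA hA' hsymm b)
    have h3 : 0 ≤ ‖b‖ ^ 2 / (2 * L) := by positivity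
    simp only [quadModel] at h2
    constructor <;> linarith

/-- One iteration contracts the optimality gap of the subsampled function, up to `ν`. -/
theorem IsStep.contraction {g : ℕ → Vec n → ℝ} {m L : ℝ} (hm : 0 < m) (hmL : m ≤ L)
    (hg : ∀ i, ContDiff ℝ 2 (g i))
    (hh : ∀ i y v, m * ‖v‖ ^ 2 ≤ inner ℝ v (hess (g i) y v) ∧
      inner ℝ v (hess (g i) y v) ≤ L * ‖v‖ ^ 2)
    {c ηbar ν : ℝ} (hc : c ∈ Set.Ioo (0 : ℝ) 1) (hη : ηbar ∈ Set.Ioo (0 : ℝ) 1) (hν : 0 ≤ ν)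
    {S : Finset ℕ} (hS : S.Nonempty) {x x' : Vec n} (h : IsStep g c ηbar ν S x x') (z : Vec n) :
    subFun g S x' - subFun g S z ≤
      (1 - c * ((1 - c) * m / (2 * L)) * (m / L)) * (subFun g S x - subFun g S z) +
        ν := by
  obtain ⟨D, hD, η, hη0, hη1, s, ⟨i, hsi⟩, hres, j, ⟨hj, hjmin⟩, rfl⟩ := h
  have hL : 0 < L := hm.trans_le hmL
  have hQ : QuadBounds m L (subFun g S) (subGrad g S) :=
    QuadBounds.avg hS fun i => quadBounds_of_hess (hg i) (hh i)
  have hinner : ∀ v w, inner ℝ (subHess g D x v) w =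
      avg D (fun i => (inner ℝ (hess (g i) x v) w : ℝ)) := fun v w => by
    rw [subHess, avg_apply, inner_avg_left]
  have hA1 : ∀ v, m * ‖v‖ ^ 2 ≤ inner ℝ v (subHess g D x v) := fun v => by
    rw [real_inner_comm, hinner, ← avg_const hD (m * ‖v‖ ^ 2)]
    exact avg_mono fun i => by rw [real_inner_comm]; exact (hh i x v).1
  have hA2 : ∀ v, inner ℝ v (subHess g D x v) ≤ L * ‖v‖ ^ 2 := fun v => by
    rw [real_inner_comm, hinner, ← avg_const hD (L * ‖v‖ ^ 2)]
    exact avg_mono fun i => by rw [real_inner_comm]; exact (hh i x v).2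
  have hsymm : ∀ v w, inner ℝ (subHess g D x v) w = (inner ℝ v (subHess g D x w) : ℝ) :=
    fun v w => by
      rw [real_inner_comm _ v, hinner, hinner]
      congr 1
      funext i
      rw [hess_symm (hg i), real_inner_comm]
  obtain ⟨hd1, hd2⟩ := cgIterate_descent (b := -subGrad g S x) (i := i) (η := η) hm hL hA1 hA2
    hsymm (hη1.trans hη.2) (by rw [← hsi, sub_neg_eq_add, norm_neg]; exact hres)
  rw [← hsi] at hd1 hd2
  rw [norm_neg] at hd2
  set d : ℝ := inner ℝ s (-subGrad g S x) with hd
  have hd' : inner ℝ s (subGrad g S x) = -d := by rw [hd, inner_neg_right, neg_neg]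
  have hd0 : 0 ≤ d := le_trans (by positivity) hd1
  set τ := (1 - c) * m / (2 * L) with hτ
  have h1c : 0 < 1 - c := by linarith [hc.2]
  have hτ0 : 0 < τ := by positivity
  -- The threshold is `2 * τ` because backtracking halves: a rejected predecessor exceeds `2 * τ`,
  -- so the accepted step is at least `τ`.
  have hsmall : ∀ t : ℝ, 0 ≤ t → t ≤ 2 * τ → LineSearch g S c ν x s t := by
    intro t ht0 ht
    have h1 := (hQ x (x + t • s)).2
    rw [add_sub_cancel_left, inner_smul_right, real_inner_comm, hd', norm_smul, mul_pow,
      Real.norm_of_nonneg ht0] at h1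
    rw [LineSearch, hd']
    have h2 : L / 2 * (t ^ 2 * ‖s‖ ^ 2) ≤ t * ((1 - c) * d) := by
      have e1 : L / 2 * (t ^ 2 * ‖s‖ ^ 2) = t * (L * t / m * (m / 2 * ‖s‖ ^ 2)) := by
        field_simp
      have e2 : L * t / m ≤ 1 - c := by
        rw [div_le_iff₀ hm]
        calc L * t ≤ L * (2 * τ) := by gcongr
          _ = (1 - c) * m := by rw [hτ]; field_simp
      rw [e1]
      exact mul_le_mul_of_nonneg_left (mul_le_mul e2 hd1 (by positivity) h1c.le) ht0
    linarith
  have ht : τ ≤ (1 / 2 : ℝ) ^ j := by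
    rcases Nat.eq_zero_or_pos j with rfl | hjpos
    · rw [pow_zero, hτ, div_le_one (by positivity)]
      nlinarith [hc.1]
    · by_contra! hlt
      obtain ⟨j, rfl⟩ : ∃ l, j = l + 1 := ⟨j - 1, by omega⟩
      have : j + 1 ≤ j := hjmin (hsmall _ (by positivity) (by rw [pow_succ] at hlt; linarith))
      omega
  change LineSearch g S c ν x s _ at hj
  rw [LineSearch, hd'] at hj
  set t := (1 / 2 : ℝ) ^ j
  have h3 := hQ.sub_le_norm_sq hm x z
  -- No sign of the gap is used, so `z` may be the minimizer of `f` rather than of the subsampled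
  -- function.
  have h4 : m / L * (subFun g S x - subFun g S z) ≤ d := by
    refine le_trans ?_ hd2
    rw [le_div_iff₀ (by positivity)]
    calc m / L * (subFun g S x - subFun g S z) * (2 * L)
        = 2 * m * (subFun g S x - subFun g S z) := by field_simp
      _ ≤ _ := h3
  have h5 : c * τ * (m / L * (subFun g S x - subFun g S z)) ≤ c * t * d := by
    have hc0 := hc.1
    calc _ ≤ c * τ * d := by gcongr
      _ ≤ _ := by gcongr
  linarith

end GIN

/-! ### A law of large numbers for unbiased random samples. -/

section

open scoped ENNReal

namespace GIN

variable {Ω Ξ : Type*} [MeasurableSpace Ω]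

/-- The deviation of the average of `h` over the sample `S` from the expectation of `h`. -/
noncomputable def sampleDev (P : Measure Ω) (ζ : ℕ → Ω → Ξ) (h : Ξ → ℝ) (S : Finset ℕ) (ω : Ω) : ℝ :=
  |avg S (fun i => h (ζ i ω)) - ∫ ω', h (ζ 0 ω') ∂P|

theorem sampleDev_nonneg (P : Measure Ω) (ζ : ℕ → Ω → Ξ) (h : Ξ → ℝ) (S : Finset ℕ) (ω : Ω) :
    0 ≤ sampleDev P ζ h S ω :=
  abs_nonneg _

variable [MeasurableSpace Ξ]

theorem measurable_sampleDev (P : Measure Ω) {ζ : ℕ → Ω → Ξ} (hζ : ∀ i, Measurable (ζ i))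
    {h : Ξ → ℝ} (hh : Measurable h) (S : Finset ℕ) : Measurable (sampleDev P ζ h S) := by
  have : Measurable fun ω => avg S (fun i => h (ζ i ω)) := by
    simp only [avg, smul_eq_mul]
    exact (Finset.measurable_sum _ fun i _ => hh.comp (hζ i)).const_mul _
  exact (this.sub_const _).abs

/-- There are only countably many finite index sets, so the discrete σ-algebra suffices. -/
theorem measurable_comp_sample {S : Ω → Finset ℕ} (hS : ∀ T, MeasurableSet {ω | S ω = T})
    {g : Finset ℕ → Ω → ℝ} (hg : ∀ T, Measurable (g T)) : Measurable fun ω => g (S ω) ω := by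
  let _ : MeasurableSpace (Finset ℕ) := ⊤
  have hSm : Measurable S := measurable_to_countable' fun T => hS T
  have : Measurable fun p : Ω × Finset ℕ => g p.2 p.1 := measurable_from_prod_countable_left hg
  exact this.comp (measurable_id.prodMk hSm)

theorem measurableSet_card_lt {S : Ω → Finset ℕ} (hS : ∀ T, MeasurableSet {ω | S ω = T}) (M : ℕ) :
    MeasurableSet {ω | (S ω).card < M} := by
  have : {ω | (S ω).card < M} = ⋃ T ∈ {T : Finset ℕ | T.card < M}, {ω | S ω = T} := by
    ext ω; simp
  rw [this]
  exact .biUnion (Set.to_countable _) fun T _ => hS T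

theorem avg_eq_fin {T : Finset ℕ} {m : ℕ} (h : T.card = m) (a : ℕ → ℝ) :
    avg T a = (m : ℝ)⁻¹ * ∑ j : Fin m, a (T.orderEmbOfFin h j) := by
  rw [avg, h, smul_eq_mul, ← Finset.sum_coe_sort T]
  congr 1
  exact (Fintype.sum_equiv (T.orderIsoOfFin h).toEquiv _ _ fun j => rfl).symm

theorem map_sample_eq {P : Measure Ω} [IsProbabilityMeasure P] {ζ : ℕ → Ω → Ξ}
    (hζ : ∀ i, Measurable (ζ i)) (hindep : iIndepFun ζ P)
    (hident : ∀ i, IdentDistrib (ζ i) (ζ 0) P P) {m : ℕ} (T : Finset ℕ) (h : T.card = m) :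
    P.map (fun ω (j : Fin m) => ζ (T.orderEmbOfFin h j) ω) =
      Measure.pi fun _ => P.map (ζ 0) := by
  rw [(hindep.precomp (T.orderEmbOfFin h).injective).map_fun_eq_pi_map
    fun i => (hζ _).aemeasurable]
  congr 1
  funext j
  exact (hident _).map_eq

/-- The law of the deviation depends only on the size of the sample. -/
theorem lintegral_sampleDev_eq {P : Measure Ω} [IsProbabilityMeasure P] {ζ : ℕ → Ω → Ξ}
    (hζ : ∀ i, Measurable (ζ i)) (hindep : iIndepFun ζ P)
    (hident : ∀ i, IdentDistrib (ζ i) (ζ 0) P P) {h : Ξ → ℝ} (hh : Measurable h)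
    {φ : ℝ → ℝ≥0∞} (hφ : Measurable φ) {T T' : Finset ℕ} (hT : T.card = T'.card) :
    ∫⁻ ω, φ (sampleDev P ζ h T ω) ∂P = ∫⁻ ω, φ (sampleDev P ζ h T' ω) ∂P := by
  let Ψ : (Fin T'.card → Ξ) → ℝ≥0∞ := fun z =>
    φ |(T'.card : ℝ)⁻¹ * ∑ j, h (z j) - ∫ ω', h (ζ 0 ω') ∂P|
  have hΨ : Measurable Ψ := by
    refine hφ.comp (((Finset.measurable_sum _ fun j _ => ?_).const_mul _).sub_const _).abs
    exact hh.comp (measurable_pi_apply j)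
  have key : ∀ R : Finset ℕ, R.card = T'.card → ∫⁻ ω, φ (sampleDev P ζ h R ω) ∂P =
      ∫⁻ z, Ψ z ∂(Measure.pi fun _ => P.map (ζ 0)) := by
    intro R hR
    rw [← map_sample_eq hζ hindep hident R hR,
      lintegral_map hΨ (measurable_pi_lambda _ fun j => hζ _)]
    simp only [sampleDev, avg_eq_fin hR, Ψ]
  rw [key T hT, key T' rfl]

theorem tendsto_sampleDev_range {P : Measure Ω} [IsProbabilityMeasure P] {ζ : ℕ → Ω → Ξ}
    (hindep : iIndepFun ζ P) (hident : ∀ i, IdentDistrib (ζ i) (ζ 0) P P)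
    {h : Ξ → ℝ} (hh : Measurable h) (hint : Integrable (fun ω => h (ζ 0 ω)) P) :
    ∀ᵐ ω ∂P, Tendsto (fun m => sampleDev P ζ h (Finset.range m) ω) atTop (𝓝 0) := by
  have := strong_law_ae_real (fun i ω => h (ζ i ω)) hint
    (fun i j hij => (hindep.indepFun hij).comp hh hh) (fun i => (hident i).comp hh)
  filter_upwards [this] with ω hω
  have h1 := (tendsto_sub_nhds_zero_iff.2 hω).abs
  rw [abs_zero] at h1
  refine h1.congr fun m => ?_
  simp only [sampleDev, avg, Finset.card_range, smul_eq_mul, div_eq_inv_mul]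

theorem lintegral_le_of_sample {P : Measure Ω} {S : Ω → Finset ℕ}
    (hS : ∀ T, MeasurableSet {ω | S ω = T}) {a b : Ω → ℝ≥0∞}
    (h : ∀ T, ∫⁻ ω in {ω | S ω = T}, a ω ∂P ≤ ∫⁻ ω in {ω | S ω = T}, b ω ∂P) :
    ∫⁻ ω, a ω ∂P ≤ ∫⁻ ω, b ω ∂P := by
  have hU : (⋃ T, {ω | S ω = T}) = Set.univ := by ext ω; simp
  have hd : Pairwise (Function.onFun Disjoint fun T => {ω | S ω = T}) := by
    intro T T' hTT'
    rw [Function.onFun, Set.disjoint_left]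
    rintro ω rfl h2
    exact hTT' h2
  rw [← setLIntegral_univ a, ← setLIntegral_univ b, ← hU, lintegral_iUnion hS hd,
    lintegral_iUnion hS hd]
  exact ENNReal.tsum_le_tsum h

/-- The tail supremum of the truncated deviations of the running averages. -/
noncomputable def tailDev (P : Measure Ω) (ζ : ℕ → Ω → Ξ) (h : Ξ → ℝ) (B : ℝ) (M : ℕ) (ω : Ω) :
    ℝ≥0∞ :=
  ⨆ m, ENNReal.ofReal (min B (sampleDev P ζ h (Finset.range (M + m)) ω))

/-- The strong law makes the tail supremum vanish almost surely; truncation at `B` supplies the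
constant majorant. -/
theorem tendsto_lintegral_tailDev {P : Measure Ω} [IsProbabilityMeasure P] {ζ : ℕ → Ω → Ξ}
    (hζ : ∀ i, Measurable (ζ i))
    (hindep : iIndepFun ζ P) (hident : ∀ i, IdentDistrib (ζ i) (ζ 0) P P)
    {h : Ξ → ℝ} (hh : Measurable h) (hint : Integrable (fun ω => h (ζ 0 ω)) P) (B : ℝ) :
    Tendsto (fun M => ∫⁻ ω, tailDev P ζ h B M ω ∂P) atTop (𝓝 0) := by
  rw [← lintegral_zero (μ := P)]
  refine tendsto_lintegral_of_dominated_convergence (fun _ => ENNReal.ofReal B) (fun M => ?_)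
    (fun M => ?_) (by simp) ?_
  · exact .iSup fun m => (measurable_const.min (measurable_sampleDev P hζ hh _)).ennreal_ofReal
  · exact .of_forall fun ω => iSup_le fun m => ENNReal.ofReal_le_ofReal (min_le_left _ _)
  · filter_upwards [tendsto_sampleDev_range hindep hident hh hint] with ω hω
    rw [ENNReal.tendsto_atTop_zero]
    intro ε hε
    have h1 : Tendsto (fun m => ENNReal.ofReal (sampleDev P ζ h (Finset.range m) ω)) atTop
        (𝓝 0) := by
      simpa using ENNReal.tendsto_ofReal hω
    obtain ⟨M, hM⟩ := ENNReal.tendsto_atTop_zero.1 h1 ε hε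
    exact ⟨M, fun M' hM' => iSup_le fun m =>
      (ENNReal.ofReal_le_ofReal (min_le_right _ _)).trans (hM _ (by omega))⟩

/-- The tail supremum serves all sizes from `M` on at once, so a random size does no harm; on
smaller samples the truncation level is the bound. In the first alternative of `Unbiased`,
independence factors the integral over `{S = T}`, and equality of laws replaces `T` by an initial
segment. In the second the sample already is one, and the bound is pointwise. -/
theorem lintegral_sampleDev_le {P : Measure Ω} [IsProbabilityMeasure P] {ζ : ℕ → Ω → Ξ}
    (hζ : ∀ i, Measurable (ζ i))
    (hindep : iIndepFun ζ P) (hident : ∀ i, IdentDistrib (ζ i) (ζ 0) P P)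
    {h : Ξ → ℝ} (hh : Measurable h) (B : ℝ) {S : Ω → Finset ℕ}
    (hSm : ∀ T, MeasurableSet {ω | S ω = T}) (hS : Unbiased P ζ S) (M : ℕ) :
    ∫⁻ ω, ENNReal.ofReal (min B (sampleDev P ζ h (S ω) ω)) ∂P ≤
      ∫⁻ ω, tailDev P ζ h B M ω ∂P + ENNReal.ofReal B * P {ω | (S ω).card < M} := by
  have hcm := measurableSet_card_lt hSm M
  have hle : ∀ {R : Finset ℕ}, M ≤ R.card → ∀ ω,
      ENNReal.ofReal (min B (sampleDev P ζ h (Finset.range R.card) ω)) ≤ tailDev P ζ h B M ω := by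
    intro R hR ω
    obtain ⟨m, hm⟩ := Nat.exists_eq_add_of_le hR
    rw [hm]
    exact le_iSup (fun m => ENNReal.ofReal (min B (sampleDev P ζ h (Finset.range (M + m)) ω))) m
  have hind : ENNReal.ofReal B * P {ω | (S ω).card < M} =
      ∫⁻ ω, {ω | (S ω).card < M}.indicator (fun _ => ENNReal.ofReal B) ω ∂P := by
    rw [lintegral_indicator_const hcm]
  rcases hS with hS | hS
  · have hI : ∀ c : ℝ≥0∞, c + ENNReal.ofReal B * P {ω | (S ω).card < M} =
      ∫⁻ ω, (c + {ω | (S ω).card < M}.indicator (fun _ => ENNReal.ofReal B) ω) ∂P := by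
      intro c
      rw [lintegral_add_left measurable_const, hind]
      simp
    rw [hI]
    refine lintegral_le_of_sample hSm fun T => ?_
    rw [setLIntegral_congr_fun (g := fun ω => ENNReal.ofReal (min B (sampleDev P ζ h T ω)))
      (hSm T) (fun ω (hω : S ω = T) => by simp only [hω])]
    rcases lt_or_ge T.card M with hT | hT
    · refine setLIntegral_mono' (hSm T) fun ω (hω : S ω = T) => ?_
      have : ω ∈ {ω | (S ω).card < M} := by simpa [hω] using hT
      rw [Set.indicator_of_mem this]
      exact (ENNReal.ofReal_le_ofReal (min_le_left _ _)).trans le_add_self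
    · have hprod : ∫⁻ ω in {ω | S ω = T}, ENNReal.ofReal (min B (sampleDev P ζ h T ω)) ∂P =
          P {ω | S ω = T} * ∫⁻ ω, ENNReal.ofReal (min B (sampleDev P ζ h T ω)) ∂P := by
        classical
        let u : Prop → ℝ≥0∞ := fun p => if p then 1 else 0
        let w : (T → Ξ) → ℝ≥0∞ := fun z => ENNReal.ofReal (min B
          |(T.card : ℝ)⁻¹ * ∑ j, h (z j) - ∫ ω', h (ζ 0 ω') ∂P|)
        have hu : Measurable u := measurable_from_top
        have hw : Measurable w := by
          refine (measurable_const.min (((Finset.measurable_sum _ fun j _ => ?_).const_mul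
            _).sub_const _).abs).ennreal_ofReal
          exact hh.comp (measurable_pi_apply j)
        have hwe : ∀ ω, ENNReal.ofReal (min B (sampleDev P ζ h T ω)) = w (fun i => ζ i ω) := by
          intro ω
          simp only [w, sampleDev, avg, smul_eq_mul]
          rw [← Finset.sum_coe_sort T]
        have hum : Measurable fun ω => u (S ω = T) :=
          Measurable.ite (hSm T) measurable_const measurable_const
        have hind := lintegral_mul_eq_lintegral_mul_lintegral_of_indepFun hum
          (hw.comp (measurable_pi_lambda _ fun i : T => hζ i)) ((hS T).comp hu hw)
        have h1 : ∫⁻ ω, u (S ω = T) ∂P = P {ω | S ω = T} := by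
          rw [← lintegral_indicator_one (hSm T)]
          rfl
        rw [h1] at hind
        simp only [hwe]
        refine Eq.trans ?_ hind
        rw [← lintegral_indicator (hSm T)]
        congr 1
        funext ω
        by_cases hω : S ω = T <;> simp [Set.indicator, hω, u]
      rw [hprod]
      calc _ ≤ P {ω | S ω = T} * ∫⁻ ω, tailDev P ζ h B M ω ∂P := by
            refine mul_le_mul' le_rfl ?_
            rw [lintegral_sampleDev_eq (φ := fun r => ENNReal.ofReal (min B r)) hζ hindep hident hh
              (measurable_const.min measurable_id).ennreal_ofReal
              (T' := Finset.range T.card) (by simp)]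
            exact lintegral_mono (hle hT)
        _ = ∫⁻ ω in {ω | S ω = T}, (∫⁻ ω, tailDev P ζ h B M ω ∂P) ∂P := by
            rw [setLIntegral_const, mul_comm]
        _ ≤ _ := lintegral_mono fun ω => le_self_add
  · rw [hind, ← lintegral_add_right _ (measurable_const.indicator hcm)]
    refine lintegral_mono_ae ?_
    filter_upwards [hS] with ω ⟨m, hm⟩
    rcases lt_or_ge (S ω).card M with hT | hT
    · rw [Set.indicator_of_mem (show ω ∈ {ω | (S ω).card < M} from hT)]
      exact (ENNReal.ofReal_le_ofReal (min_le_left _ _)).trans le_add_self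
    · refine le_trans ?_ le_self_add
      have := hle hT ω
      rwa [show Finset.range (S ω).card = S ω by rw [hm, Finset.card_range]] at this

/-- A law of large numbers for unbiased random samples whose sizes tend to infinity. -/
theorem tendsto_integral_sampleDev {P : Measure Ω} [IsProbabilityMeasure P] {ζ : ℕ → Ω → Ξ}
    (hζ : ∀ i, Measurable (ζ i))
    (hindep : iIndepFun ζ P) (hident : ∀ i, IdentDistrib (ζ i) (ζ 0) P P)
    {h : Ξ → ℝ} (hh : Measurable h) (hint : Integrable (fun ω => h (ζ 0 ω)) P) {B : ℝ}
    (hB : 0 ≤ B) {S : ℕ → Ω → Finset ℕ}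
    (hSm : ∀ k T, MeasurableSet {ω | S k ω = T}) (hS : ∀ k, Unbiased P ζ (S k))
    (hcard : ∀ᵐ ω ∂P, Tendsto (fun k => (S k ω).card) atTop atTop) :
    Tendsto (fun k => ∫ ω, min B (sampleDev P ζ h (S k ω) ω) ∂P) atTop (𝓝 0) := by
  have hcm := fun k M => measurableSet_card_lt (hSm k) M
  have hP : ∀ M, Tendsto (fun k => P {ω | (S k ω).card < M}) atTop (𝓝 0) := by
    intro M
    have h1 : Tendsto (fun k => ∫⁻ ω, {ω | (S k ω).card < M}.indicator (fun _ => (1 : ℝ≥0∞)) ω ∂P)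
        atTop (𝓝 (∫⁻ _, 0 ∂P)) := by
      refine tendsto_lintegral_of_dominated_convergence (fun _ => 1)
        (fun k => measurable_const.indicator (hcm k M))
        (fun k => .of_forall fun ω => Set.indicator_le_self _ _ _) (by simp) ?_
      filter_upwards [hcard] with ω hω
      refine tendsto_const_nhds.congr' ?_
      filter_upwards [hω.eventually_ge_atTop M] with k hk
      rw [Set.indicator_of_notMem]
      simpa using hk
    simpa [lintegral_indicator_const (hcm _ M)] using h1
  have hlim : Tendsto (fun k => ∫⁻ ω, ENNReal.ofReal (min B (sampleDev P ζ h (S k ω) ω)) ∂P) atTop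
      (𝓝 0) := by
    rw [ENNReal.tendsto_nhds_zero]
    intro ε hε
    have hε2 : 0 < ε / 2 := ENNReal.half_pos hε.ne'
    obtain ⟨M, hM⟩ := ((ENNReal.tendsto_nhds_zero.1
      (tendsto_lintegral_tailDev hζ hindep hident hh hint B)) (ε / 2) hε2).exists
    have h2 : Tendsto (fun k => ENNReal.ofReal B * P {ω | (S k ω).card < M}) atTop (𝓝 0) := by
      simpa using ENNReal.Tendsto.const_mul (hP M) (Or.inr ENNReal.ofReal_ne_top)
    filter_upwards [ENNReal.tendsto_nhds_zero.1 h2 (ε / 2) hε2] with k hk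
    calc _ ≤ _ := lintegral_sampleDev_le hζ hindep hident hh B (hSm k) (hS k) M
      _ ≤ ε / 2 + ε / 2 := add_le_add hM hk
      _ = ε := ENNReal.add_halves ε
  have h3 := (ENNReal.tendsto_toReal ENNReal.zero_ne_top).comp hlim
  refine h3.congr fun k => ?_
  have hm : Measurable fun ω => min B (sampleDev P ζ h (S k ω) ω) :=
    measurable_const.min (measurable_comp_sample (hSm k) (measurable_sampleDev P hζ hh))
  exact (integral_eq_lintegral_of_nonneg_ae (.of_forall fun ω => le_min hB (sampleDev_nonneg ..))
    hm.aestronglyMeasurable).symm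

end GIN

end

/-! ### Expectations, uniform deviation on compact sets, and the scalar recursion. -/

namespace GIN

variable {n : ℕ} {Ω Ξ : Type*} [MeasurableSpace Ω]

/-- Each coordinate is a pointwise limit of difference quotients with increments `1 / k`. -/
theorem measurable_gradient [MeasurableSpace Ξ] {F : Vec n → Ξ → ℝ} (hF : ∀ y, Measurable (F y))
    (hd : ∀ z, Differentiable ℝ fun y => F y z) (y : Vec n) :
    Measurable fun z => gradient (fun y' => F y' z) y := by
  have hinner : ∀ v : Vec n, Measurable fun z =>
      (inner ℝ v (gradient (fun y' => F y' z) y) : ℝ) := by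
    intro v
    refine measurable_of_tendsto_metrizable (f := fun (k : ℕ) z =>
      (k : ℝ) • (F (y + (k : ℝ)⁻¹ • v) z - F y z))
      (fun k => ((hF _).sub (hF _)).const_smul (k : ℝ)) ?_
    rw [tendsto_pi_nhds]
    intro z
    have := ((hd z y).hasGradientAt.hasFDerivAt.lim_real v).comp tendsto_natCast_atTop_atTop
    rw [real_inner_comm]
    exact this
  have hsum : (fun z => gradient (fun y' => F y' z) y) = fun z => ∑ i,
      (inner ℝ (EuclideanSpace.basisFun (Fin n) ℝ i) (gradient (fun y' => F y' z) y) : ℝ) •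
        EuclideanSpace.basisFun (Fin n) ℝ i := by
    funext z
    exact ((EuclideanSpace.basisFun (Fin n) ℝ).sum_repr' _).symm
  rw [hsum]
  exact Finset.measurable_sum _ fun i _ => (hinner _).smul_const _

section Integral

variable {P : Measure Ω} [IsProbabilityMeasure P] {m L : ℝ} {H : Vec n → Ω → ℝ}
  {G : Vec n → Ω → Vec n}

theorem integrable_of_quadBounds (hm : 0 ≤ m) (hL : 0 ≤ L)
    (hQ : ∀ᵐ ω ∂P, QuadBounds m L (fun y => H y ω) (fun y => G y ω))
    (hH : ∀ y, AEStronglyMeasurable (H y) P) {y₀ : Vec n} (h₀ : Integrable (H y₀) P)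
    (hG₀ : Integrable (G y₀) P) (y : Vec n) : Integrable (H y) P := by
  refine ((h₀.norm.add (hG₀.norm.mul_const ‖y - y₀‖)).add
    (integrable_const (L / 2 * ‖y - y₀‖ ^ 2))).mono' (hH y) ?_
  filter_upwards [hQ] with ω hω
  have h1 := hω.abs_sub_le hm hL y₀ y
  have h2 := norm_sub_norm_le (H y ω) (H y₀ ω)
  rw [Real.norm_eq_abs (H y ω - _)] at h2
  simp only [Pi.add_apply]
  linarith

/-- The sandwich at `y` and `y + v` bounds the `v`-component of the gradient by two function values
and a constant. -/
theorem integrable_gradient_of_quadBounds (hm : 0 ≤ m) (hL : 0 ≤ L)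
    (hQ : ∀ᵐ ω ∂P, QuadBounds m L (fun y => H y ω) (fun y => G y ω))
    (hint : ∀ y, Integrable (H y) P) (hG : ∀ y, AEStronglyMeasurable (G y) P) (y : Vec n) :
    Integrable (G y) P := by
  have hsum : G y = fun ω => ∑ i,
      (inner ℝ (EuclideanSpace.basisFun (Fin n) ℝ i) (G y ω) : ℝ) •
        EuclideanSpace.basisFun (Fin n) ℝ i := by
    funext ω
    exact ((EuclideanSpace.basisFun (Fin n) ℝ).sum_repr' _).symm
  rw [hsum]
  refine integrable_finsetSum _ fun i _ => Integrable.smul_const ?_ _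
  set v := EuclideanSpace.basisFun (Fin n) ℝ i
  refine (((hint (y + v)).norm.add (hint y).norm).add
    (integrable_const (L / 2 * ‖v‖ ^ 2))).mono' ((hG y).const_inner) ?_
  filter_upwards [hQ] with ω hω
  have h1 := hω y (y + v)
  rw [add_sub_cancel_left] at h1
  have h2 : 0 ≤ m / 2 * ‖v‖ ^ 2 := by positivity
  have h3 : 0 ≤ L / 2 * ‖v‖ ^ 2 := by positivity
  rw [real_inner_comm, Real.norm_eq_abs]
  simp only [Pi.add_apply, Real.norm_eq_abs]
  have h4 := abs_le.1 (le_refl |H y ω|)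
  have h5 := abs_le.1 (le_refl |H (y + v) ω|)
  rw [abs_le]
  constructor <;> linarith [h1.1, h1.2, h4.1, h4.2, h5.1, h5.2]

theorem quadBounds_integral
    (hQ : ∀ᵐ ω ∂P, QuadBounds m L (fun y => H y ω) (fun y => G y ω))
    (hint : ∀ y, Integrable (H y) P) (hG : ∀ y, Integrable (G y) P) :
    QuadBounds m L (fun y => ∫ ω, H y ω ∂P) (fun y => ∫ ω, G y ω ∂P) := by
  intro x y
  have hi : Integrable (fun ω => H x ω + inner ℝ (G x ω) (y - x)) P :=
    (hint x).add ((hG x).inner_const _)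
  have key : ∀ d : ℝ, ∫ ω, (H x ω + inner ℝ (G x ω) (y - x) + d) ∂P =
      ∫ ω, H x ω ∂P + inner ℝ (∫ ω, G x ω ∂P) (y - x) + d := by
    intro d
    rw [integral_add hi (integrable_const d), integral_add (hint x) ((hG x).inner_const _)]
    simp only [real_inner_comm (y - x)]
    rw [integral_inner (hG x)]
    simp
  simp only [← key]
  constructor
  · refine integral_mono_ae (hi.add (integrable_const _)) (hint y) ?_
    filter_upwards [hQ] with ω hω using (hω x y).1
  · refine integral_mono_ae (hint y) (hi.add (integrable_const _)) ?_
    filter_upwards [hQ] with ω hω using (hω x y).2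

end Integral

/-- On a compact set the subsampled functions deviate from their expectation by at most the
deviations of finitely many averages. -/
theorem exists_uniform_dev_le {P : Measure Ω} [IsProbabilityMeasure P] {ζ : ℕ → Ω → Ξ}
    {F : Vec n → Ξ → ℝ} {m L : ℝ} (hm : 0 ≤ m) (hL : 0 ≤ L)
    (hQ : ∀ᵐ ω ∂P, ∀ i, QuadBounds m L (fun y => F y (ζ i ω))
      (fun y => gradient (fun y' => F y' (ζ i ω)) y))
    (hint : ∀ y, Integrable (fun ω => F y (ζ 0 ω)) P)
    (hG : ∀ y, Integrable (fun ω => gradient (fun y' => F y' (ζ 0 ω)) y) P)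
    {K : Set (Vec n)} (hK : IsCompact K) {ε : ℝ} (hε : 0 < ε) :
    ∃ t : Finset (Vec n), ∀ᵐ ω ∂P, ∀ S : Finset ℕ, S.Nonempty → ∀ y ∈ K,
      |subFun (fun i y => F y (ζ i ω)) S y - ∫ ω', F y (ζ 0 ω') ∂P| ≤
        ε + ∑ j ∈ t, (sampleDev P ζ (F j) S ω +
          sampleDev P ζ (fun z => ‖gradient (fun y' => F y' z) j‖) S ω) := by
  set l : Vec n → ℝ := fun y => ∫ ω, ‖gradient (fun y' => F y' (ζ 0 ω)) y‖ ∂P with hl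
  have hl0 : ∀ y, 0 ≤ l y := fun y => integral_nonneg fun ω => norm_nonneg _
  -- Within distance `d` of a centre, the two functions together vary by at most `(a + 2 * l) * d +
  -- L * d ^ 2`, with `a` the deviation of the averaged gradient norm. Radius at most `1` turns this
  -- into `a + (2 * l + L) * d`; the summand `1` keeps the denominator positive.
  set r : Vec n → ℝ := fun y => min 1 (ε / (2 * l y + L + 1)) with hr
  have hpos : ∀ y, 0 < 2 * l y + L + 1 := fun y => by have := hl0 y; positivity
  have hr0 : ∀ y, 0 < r y := fun y => lt_min one_pos (div_pos hε (hpos y))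
  obtain ⟨t, -, ht⟩ := hK.elim_nhds_subcover (fun y => Metric.ball y (r y))
    fun y _ => Metric.ball_mem_nhds y (hr0 y)
  refine ⟨t, ?_⟩
  have hQf := quadBounds_integral (hQ.mono fun ω h => h 0) hint hG
  filter_upwards [hQ] with ω hω S hS y hy
  have hQS : QuadBounds m L (subFun (fun i y => F y (ζ i ω)) S)
    (subGrad (fun i y => F y (ζ i ω)) S) := QuadBounds.avg hS hω
  obtain ⟨j, hj, hyj⟩ := Set.mem_iUnion₂.1 (ht hy)
  rw [Metric.mem_ball, dist_eq_norm] at hyj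
  set d := ‖y - j‖ with hd
  have hd0 : 0 ≤ d := norm_nonneg _
  have hd1 : d ≤ 1 := hyj.le.trans (min_le_left _ _)
  have hdε : d * (2 * l j + L + 1) ≤ ε :=
    (le_div_iff₀ (hpos j)).1 (hyj.le.trans (min_le_right _ _))
  have hd2 : L / 2 * d ^ 2 ≤ L / 2 * d := by gcongr; nlinarith
  have h1 := hQS.abs_sub_le hm hL j y
  have h2 := hQf.abs_sub_le hm hL j y
  set a := sampleDev P ζ (fun z => ‖gradient (fun y' => F y' z) j‖) S ω with ha
  have ha0 : 0 ≤ a := sampleDev_nonneg ..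
  have h3 : ‖subGrad (fun i y => F y (ζ i ω)) S j‖ ≤ a + l j := by
    refine (norm_avg_le _ _).trans ?_
    have := le_abs_self (avg S (fun i => ‖gradient (fun y' => F y' (ζ i ω)) j‖) - l j)
    change _ ≤ a at this
    linarith
  have h4 : ‖∫ ω, gradient (fun y' => F y' (ζ 0 ω)) j ∂P‖ ≤ l j := norm_integral_le_integral_norm _
  have h5 := mul_le_mul_of_nonneg_right h3 hd0
  have h6 := mul_le_mul_of_nonneg_right h4 hd0
  have h7 : a * d ≤ a := mul_le_of_le_one_right ha0 hd1
  have h8 : sampleDev P ζ (F j) S ω + a ≤ ∑ j ∈ t, (sampleDev P ζ (F j) S ω +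
          sampleDev P ζ (fun z => ‖gradient (fun y' => F y' z) j‖) S ω) :=
    Finset.single_le_sum (f := fun j => sampleDev P ζ (F j) S ω +
          sampleDev P ζ (fun z => ‖gradient (fun y' => F y' z) j‖) S ω)
      (fun j _ => add_nonneg (sampleDev_nonneg ..) (sampleDev_nonneg ..)) hj
  have h9 : |subFun (fun i y => F y (ζ i ω)) S j - ∫ ω', F j (ζ 0 ω') ∂P| =
    sampleDev P ζ (F j) S ω := rfl
  have h10 := abs_sub_le (subFun (fun i y => F y (ζ i ω)) S y)
    (subFun (fun i y => F y (ζ i ω)) S j) (∫ ω', F y (ζ 0 ω') ∂P)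
  have h11 := abs_sub_le (subFun (fun i y => F y (ζ i ω)) S j) (∫ ω', F j (ζ 0 ω') ∂P)
    (∫ ω', F y (ζ 0 ω') ∂P)
  rw [abs_sub_comm (∫ ω', F j (ζ 0 ω') ∂P)] at h11
  linarith

theorem tendsto_zero_of_recursion {u : ℕ → ℝ} {ρ : ℝ} (hu : ∀ k, 0 ≤ u k) (hρ0 : 0 ≤ ρ)
    (hρ1 : ρ < 1) (h : ∀ ε > 0, ∀ᶠ k in atTop, u (k + 1) ≤ ρ * u k + ε) :
    Tendsto u atTop (𝓝 0) := by
  rw [Metric.tendsto_atTop]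
  intro ε hε
  have h1 : 0 < 1 - ρ := by linarith
  -- With this error the recursion has fixed point `ε / 2`.
  obtain ⟨N, hN⟩ := eventually_atTop.1 (h ((1 - ρ) * (ε / 2)) (by positivity))
  have hj : ∀ j, u (N + j) ≤ ρ ^ j * u N + ε / 2 := by
    intro j
    induction j with
    | zero => simp; positivity
    | succ j ih =>
      have h2 := hN (N + j) (by omega)
      have h3 := mul_le_mul_of_nonneg_left ih hρ0
      rw [← add_assoc, pow_succ]
      linarith
  have hlim : Tendsto (fun j => ρ ^ j * u N) atTop (𝓝 0) := by
    simpa using (tendsto_pow_atTop_nhds_zero_of_lt_one hρ0 hρ1).mul_const (u N)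
  obtain ⟨J, hJ⟩ := eventually_atTop.1 (hlim.eventually_lt_const (half_pos hε))
  refine ⟨N + J, fun k hk => ?_⟩
  obtain ⟨j, rfl⟩ := Nat.exists_eq_add_of_le (show N ≤ k by omega)
  rw [Real.dist_0_eq_abs, abs_of_nonneg (hu _)]
  linarith [hj j, hJ j (by omega)]

/-- Truncation is free: if some term exceeds `B`, the truncated sum alone already dominates `e`. -/
theorem le_sum_min {ι : Type*} (t : Finset ι) {a b : ι → ℝ} (ha : ∀ j, 0 ≤ a j)
    (hb : ∀ j, 0 ≤ b j) {B e r : ℝ} (hB : 0 ≤ B) (hr : 0 ≤ r) (he : e ≤ B)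
    (h : e ≤ r + 4 * ∑ j ∈ t, (a j + b j)) :
    e ≤ r + 4 * ∑ j ∈ t, (min B (a j) + min B (b j)) := by
  by_cases hall : ∀ j ∈ t, a j ≤ B ∧ b j ≤ B
  · rwa [Finset.sum_congr rfl fun j hj => by
      rw [min_eq_right (hall j hj).1, min_eq_right (hall j hj).2]]
  · push Not at hall
    obtain ⟨j, hj, hab⟩ := hall
    have h0 : ∀ j, 0 ≤ min B (a j) ∧ 0 ≤ min B (b j) := fun j =>
      ⟨le_min hB (ha j), le_min hB (hb j)⟩
    have h1 : B ≤ min B (a j) + min B (b j) := by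
      by_cases h : a j ≤ B
      · rw [min_eq_left (hab h).le]; linarith [(h0 j).1]
      · rw [min_eq_left (not_le.1 h).le]; linarith [(h0 j).2]
    have h2 := Finset.single_le_sum (f := fun j => min B (a j) + min B (b j))
      (fun j _ => add_nonneg (h0 j).1 (h0 j).2) hj
    linarith

end GIN

/-! ### The convergence theorem. -/

theorem theorem3p3 {n : ℕ} {Ω Ξ : Type*} [MeasurableSpace Ω] [MeasurableSpace Ξ]
    (P : Measure Ω) [IsProbabilityMeasure P]
    -- the random variable, the integrand, the objective function
    (ξ : Ω → Ξ) (hξ : Measurable ξ)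
    (F : GIN.Vec n → Ξ → ℝ) (hF : ∀ y, Measurable (F y))
    (f : GIN.Vec n → ℝ) (hf : ∀ y, f y = ∫ ω, F y (ξ ω) ∂P)
    -- i.i.d. samples
    (ζ : ℕ → Ω → Ξ) (hζ : ∀ i, Measurable (ζ i))
    (hindep : iIndepFun ζ P) (hident : ∀ i, IdentDistrib (ζ i) ξ P P)
    -- smoothness, and domination on an open set around the compact set `K`
    (hC2 : ∀ z, ContDiff ℝ 2 (fun y => F y z))
    (K U : Set (GIN.Vec n)) (hK : IsCompact K) (hU : IsOpen U) (hKU : K ⊆ U)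
    (Mf Mg : Ξ → ℝ)
    (hMf : Integrable (fun ω => Mf (ξ ω)) P) (hMg : Integrable (fun ω => Mg (ξ ω)) P)
    (hdomf : ∀ᵐ ω ∂P, ∀ y ∈ U, |F y (ξ ω)| ≤ Mf (ξ ω))
    (hdomg : ∀ᵐ ω ∂P, ∀ y ∈ U, ‖gradient (fun y' => F y' (ξ ω)) y‖ ≤ Mg (ξ ω))
    -- uniform bounds for the Hessians of the sample functions
    (lam1 lamn : ℝ) (hlam1 : 0 < lam1)
    (hhess : ∀ᵐ ω ∂P, ∀ (i : ℕ) (y v : GIN.Vec n),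
      lam1 * ‖v‖ ^ 2 ≤ inner ℝ v (GIN.hess (fun y' => F y' (ζ i ω)) y v) ∧
      inner ℝ v (GIN.hess (fun y' => F y' (ζ i ω)) y v) ≤ lamn * ‖v‖ ^ 2)
    -- the parameters of the algorithm
    (c ηbar : ℝ) (hc : c ∈ Set.Ioo (0 : ℝ) 1) (hη : ηbar ∈ Set.Ioo (0 : ℝ) 1)
    (ν : ℕ → ℝ) (hνpos : ∀ k, 0 < ν k) (hνsum : Summable ν)
    -- the random samples, of sizes tending to infinity
    (S : ℕ → Ω → Finset ℕ) (hSmeas : ∀ k T, MeasurableSet {ω | S k ω = T})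
    (hS : ∀ k, GIN.Unbiased P ζ (S k))
    (hcard : ∀ᵐ ω ∂P, Tendsto (fun k => (S k ω).card) atTop atTop)
    -- the random iterates, which stay in `K`
    (x : ℕ → Ω → GIN.Vec n) (hx : ∀ k, Measurable (x k))
    (hgin : ∀ᵐ ω ∂P, GIN.IsSequence (fun i y => F y (ζ i ω)) c ηbar ν
      (fun k => S k ω) (fun k => x k ω))
    (hxK : ∀ᵐ ω ∂P, ∀ k, x k ω ∈ K) :
    (∀ y, Integrable (fun ω => F y (ξ ω)) P) ∧
    ∃ xstar : GIN.Vec n,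
      (∀ y, f xstar ≤ f y) ∧
      (∀ x', (∀ y, f x' ≤ f y) → x' = xstar) ∧
      (∀ k, MemLp (fun ω => x k ω - xstar) 2 P) ∧
      Tendsto (fun k => ∫ ω, ‖x k ω - xstar‖ ^ 2 ∂P) atTop (𝓝 0) := by
  -- In dimension zero the Hessian bounds do not force `lam1 ≤ lamn`.
  set L := max lamn lam1
  have hmL : lam1 ≤ L := le_max_right _ _
  have hL : 0 < L := hlam1.trans_le hmL
  have hident0 : ∀ i, IdentDistrib (ζ i) (ζ 0) P P := fun i => (hident i).trans (hident 0).symm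
  have hd : ∀ z, Differentiable ℝ fun y => F y z := fun z => (hC2 z).differentiable (by norm_num)
  have hgm : ∀ y, Measurable fun z => gradient (fun y' => F y' z) y :=
    fun y => GIN.measurable_gradient hF hd y
  have hhess' : ∀ᵐ ω ∂P, ∀ (i : ℕ) (y v : GIN.Vec n),
      lam1 * ‖v‖ ^ 2 ≤ inner ℝ v (GIN.hess (fun y' => F y' (ζ i ω)) y v) ∧
      inner ℝ v (GIN.hess (fun y' => F y' (ζ i ω)) y v) ≤ L * ‖v‖ ^ 2 := by
    filter_upwards [hhess] with ω hω i y v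
    exact ⟨(hω i y v).1, (hω i y v).2.trans (by gcongr; exact le_max_left _ _)⟩
  have hQ : ∀ᵐ ω ∂P, ∀ i, GIN.QuadBounds lam1 L (fun y => F y (ζ i ω))
      (fun y => gradient (fun y' => F y' (ζ i ω)) y) := by
    filter_upwards [hhess'] with ω hω i
    exact GIN.quadBounds_of_hess (hC2 _) (hω i)
  -- Domination is needed at a single point of `K`, which exists because the iterates lie there; the
  -- sandwich spreads integrability to all of space.
  obtain ⟨ω₀, hω₀⟩ := hxK.exists
  set y₀ := x 0 ω₀
  have hy₀ : y₀ ∈ U := hKU (hω₀ 0)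
  have hF₀ : Integrable (fun ω => F y₀ (ζ 0 ω)) P := by
    refine ((hident 0).comp (hF y₀)).integrable_iff.2
      (hMf.mono' ((hF y₀).comp hξ).aestronglyMeasurable ?_)
    filter_upwards [hdomf] with ω hω using hω y₀ hy₀
  have hG₀ : Integrable (fun ω => gradient (fun y' => F y' (ζ 0 ω)) y₀) P := by
    refine ((hident 0).comp (hgm y₀)).integrable_iff.2
      (hMg.mono' ((hgm y₀).comp hξ).aestronglyMeasurable ?_)
    filter_upwards [hdomg] with ω hω using hω y₀ hy₀
  have hQ0 := hQ.mono fun ω h => h 0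
  have hint : ∀ y, Integrable (fun ω => F y (ζ 0 ω)) P :=
    GIN.integrable_of_quadBounds hlam1.le hL.le hQ0
      (fun y => ((hF y).comp (hζ 0)).aestronglyMeasurable) hF₀ hG₀
  have hG : ∀ y, Integrable (fun ω => gradient (fun y' => F y' (ζ 0 ω)) y) P :=
    GIN.integrable_gradient_of_quadBounds hlam1.le hL.le hQ0 hint
      (fun y => ((hgm y).comp (hζ 0)).aestronglyMeasurable)
  have hfe : f = fun y => ∫ ω, F y (ζ 0 ω) ∂P := by
    funext y
    rw [hf]
    exact ((hident 0).comp (hF y)).integral_eq.symm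
  have hQf := GIN.quadBounds_integral hQ0 hint hG
  rw [← hfe] at hQf
  have hfc : Continuous f := hQf.continuous hlam1.le hL.le
  obtain ⟨z, hz⟩ := hQf.exists_min hlam1 hL
  have hzmin : ∀ y, f z ≤ f y := fun y => le_trans (by simp; positivity) (hz y)
  obtain ⟨R, hR⟩ := hK.isBounded.exists_norm_le
  have hmem : ∀ k, MemLp (fun ω => x k ω - z) 2 P := fun k => by
    refine MemLp.of_bound ((hx k).sub_const z).aestronglyMeasurable (R + ‖z‖) ?_
    filter_upwards [hxK] with ω hω
    exact (norm_sub_le _ _).trans (by gcongr; exact hR _ (hω k))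
  refine ⟨fun y => ((hident 0).comp (hF y)).integrable_iff.1 (hint y), z, hzmin, ?_, hmem, ?_⟩
  · intro x' hx'
    have h1 := (hz x').trans (hx' z)
    have h2 : lam1 / 2 * ‖x' - z‖ ^ 2 ≤ 0 := by linarith
    have h3 : ‖x' - z‖ ^ 2 ≤ 0 := nonpos_of_mul_nonpos_right h2 (by positivity)
    exact sub_eq_zero.1 (norm_eq_zero.1
      (pow_eq_zero_iff two_ne_zero |>.1 (le_antisymm h3 (by positivity))))
  obtain ⟨B₀, hB₀⟩ := hK.exists_bound_of_continuousOn (f := fun y => f y - f z)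
    (by fun_prop)
  set B := max B₀ 0
  have hB : 0 ≤ B := le_max_right _ _
  have he0 : ∀ k ω, 0 ≤ f (x k ω) - f z := fun k ω => sub_nonneg.2 (hzmin _)
  have heB : ∀ᵐ ω ∂P, ∀ k, f (x k ω) - f z ≤ B := by
    filter_upwards [hxK] with ω hω k
    exact (le_abs_self _).trans ((hB₀ _ (hω k)).trans (le_max_left _ _))
  have heint : ∀ k, Integrable (fun ω => f (x k ω) - f z) P := fun k => by
    refine Integrable.of_bound ((hfc.measurable.comp (hx k)).sub_const _).aestronglyMeasurable B ?_
    filter_upwards [heB] with ω hω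
    rw [Real.norm_of_nonneg (he0 k ω)]
    exact hω k
  set θ := c * ((1 - c) * lam1 / (2 * L)) * (lam1 / L) with hθ
  have hc0 := hc.1
  have hc1 : 0 < 1 - c := by linarith [hc.2]
  have hθ0 : 0 < θ := by positivity
  have hθ1 : θ ≤ 1 := by
    have h1 : lam1 / L ≤ 1 := (div_le_one hL).2 hmL
    have h2 : (1 - c) * lam1 / (2 * L) ≤ 1 := by
      rw [div_le_one (by positivity)]
      nlinarith
    calc θ ≤ 1 * 1 * 1 := by rw [hθ]; gcongr; exact hc.2.le
      _ = 1 := by norm_num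
  have hρ : 0 ≤ 1 - θ := by linarith
  have hu : Tendsto (fun k => ∫ ω, (f (x k ω) - f z) ∂P) atTop (𝓝 0) := by
    refine GIN.tendsto_zero_of_recursion (ρ := 1 - θ) (fun k => integral_nonneg (he0 k)) hρ
      (by linarith) fun ε hε => ?_
    -- The minimizer may lie outside `K`, hence the insertion. The level `ε / 8`, counted four
    -- times, uses half of `ε`; the other half absorbs `ν k` and the expected deviations.
    obtain ⟨t, ht⟩ := GIN.exists_uniform_dev_le hlam1.le hL.le hQ hint hG (hK.insert z)
      (show 0 < ε / 8 by positivity)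
    let a : ℕ → GIN.Vec n → Ω → ℝ := fun k j ω => GIN.sampleDev P ζ (F j) (S k ω) ω
    let b : ℕ → GIN.Vec n → Ω → ℝ := fun k j ω =>
      GIN.sampleDev P ζ (fun z => ‖gradient (fun y' => F y' z) j‖) (S k ω) ω
    have hmin : ∀ {h : Ξ → ℝ}, Measurable h → ∀ k,
        Integrable (fun ω => min B (GIN.sampleDev P ζ h (S k ω) ω)) P := by
      intro h hh k
      refine Integrable.of_bound (measurable_const.min (GIN.measurable_comp_sample (hSmeas k)
        (GIN.measurable_sampleDev P hζ hh))).aestronglyMeasurable B (.of_forall fun ω => ?_)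
      rw [Real.norm_of_nonneg (le_min hB (GIN.sampleDev_nonneg ..))]
      exact min_le_left _ _
    have haint : ∀ k j, Integrable (fun ω => min B (a k j ω)) P := fun k j => hmin (hF j) k
    have hbint : ∀ k j, Integrable (fun ω => min B (b k j ω)) P := fun k j => hmin (hgm j).norm k
    have hstep : ∀ k, ∀ᵐ ω ∂P, f (x (k + 1) ω) - f z ≤ (1 - θ) * (f (x k ω) - f z) +
        (ν k + ε / 2) + 4 * ∑ j ∈ t, (min B (a k j ω) + min B (b k j ω)) := by
      intro k
      filter_upwards [ht, hhess', hgin, hxK, heB] with ω ht hh hseq hK' hB'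
      have hne : (S k ω).Nonempty := (hseq k).1
      have hst : GIN.IsStep (fun i y => F y (ζ i ω)) c ηbar (ν k) (S k ω) (x k ω) (x (k + 1) ω) :=
        (hseq k).2
      have hcon := hst.contraction hlam1 hmL (fun i => hC2 _) hh hc hη (hνpos k).le hne z
      rw [← hθ] at hcon
      have hdev := ht (S k ω) hne
      simp only [show ∀ y, ∫ ω', F y (ζ 0 ω') ∂P = f y from fun y => (congrFun hfe y).symm] at hdev
      have d1 := abs_le.1 (hdev (x k ω) (Or.inr (hK' k)))
      have d2 := abs_le.1 (hdev (x (k + 1) ω) (Or.inr (hK' (k + 1))))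
      have d3 := abs_le.1 (hdev z (Or.inl rfl))
      refine GIN.le_sum_min t (fun j => GIN.sampleDev_nonneg ..)
        (fun j => GIN.sampleDev_nonneg ..) hB ?_ (hB' _) ?_
      · have := mul_nonneg hρ (he0 k ω)
        have := hνpos k
        positivity
      · set Δ := ε / 8 + ∑ j ∈ t, (a k j ω + b k j ω)
        have hΔ : 0 ≤ Δ := by
          have : 0 ≤ ∑ j ∈ t, (a k j ω + b k j ω) :=
            Finset.sum_nonneg fun j _ => add_nonneg (GIN.sampleDev_nonneg ..) (GIN.sampleDev_nonneg ..)
          positivity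
        have h1 : (1 - θ) * (GIN.subFun (fun i y => F y (ζ i ω)) (S k ω) (x k ω) -
            GIN.subFun (fun i y => F y (ζ i ω)) (S k ω) z) ≤
            (1 - θ) * (f (x k ω) - f z + 2 * Δ) := by
          refine mul_le_mul_of_nonneg_left ?_ hρ
          linarith [d1.2, d3.1]
        have h2 : 0 ≤ θ * Δ := by positivity
        have h3 : 4 * Δ = ε / 2 + 4 * ∑ j ∈ t, (a k j ω + b k j ω) := by
          simp only [Δ]; ring
        -- Each gap involves two evaluations: `2 * Δ` for the new one and `(1 - θ) * (2 * Δ)` for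
        -- the old one.
        have h4 : f (x (k + 1) ω) - f z ≤ (1 - θ) * (f (x k ω) - f z) + ν k + 4 * Δ := by
          linarith [d2.1, d3.2]
        linarith
    have hlim : Tendsto (fun k => ν k + 4 * ∑ j ∈ t,
        (∫ ω, min B (a k j ω) ∂P + ∫ ω, min B (b k j ω) ∂P)) atTop (𝓝 0) := by
      have h1 : ∀ j ∈ t, Tendsto (fun k => ∫ ω, min B (a k j ω) ∂P + ∫ ω, min B (b k j ω) ∂P)
          atTop (𝓝 (0 + 0)) := fun j _ =>
        (GIN.tendsto_integral_sampleDev hζ hindep hident0 (hF j) (hint j) hB hSmeas hS hcard).add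
        (GIN.tendsto_integral_sampleDev hζ hindep hident0 (hgm j).norm (hG j).norm hB hSmeas hS
          hcard)
      simpa using hνsum.tendsto_atTop_zero.add ((tendsto_finsetSum t h1).const_mul 4)
    filter_upwards [hlim.eventually_lt_const (half_pos hε)] with k hk
    have hi1 := ((heint k).const_mul (1 - θ)).add (integrable_const (μ := P) (ν k + ε / 2))
    have hi3 : ∀ j ∈ t, Integrable (fun ω => min B (a k j ω) + min B (b k j ω)) P :=
      fun j _ => (haint k j).add (hbint k j)
    have hi2 := (integrable_finsetSum t hi3).const_mul 4
    have h1 := integral_mono_ae (heint (k + 1)) (hi1.add hi2) (hstep k)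
    have h2 : ∫ ω, ((1 - θ) * (f (x k ω) - f z) + (ν k + ε / 2) +
        4 * ∑ j ∈ t, (min B (a k j ω) + min B (b k j ω))) ∂P =
        (1 - θ) * ∫ ω, (f (x k ω) - f z) ∂P + (ν k + ε / 2) +
        4 * ∑ j ∈ t, (∫ ω, min B (a k j ω) ∂P + ∫ ω, min B (b k j ω) ∂P) := by
      refine (integral_add hi1 hi2).trans ?_
      congr 1
      · refine (integral_add ((heint k).const_mul _) (integrable_const _)).trans ?_
        rw [integral_const_mul]
        simp
      · rw [integral_const_mul, integral_finsetSum t hi3]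
        exact congrArg _ (Finset.sum_congr rfl fun j _ => integral_add (haint k j) (hbint k j))
    have h3 := h1.trans_eq h2
    linarith
  refine squeeze_zero (fun k => integral_nonneg fun ω => by positivity) (fun k => ?_)
    (by simpa using hu.const_mul (2 / lam1))
  rw [← integral_const_mul]
  refine integral_mono_ae (by simpa using (hmem k).integrable_norm_pow two_ne_zero)
    ((heint k).const_mul _) (.of_forall fun ω => ?_)
  have h1 := hz (x k ω)
  have h2 : lam1 / 2 * ‖x k ω - z‖ ^ 2 ≤ f (x k ω) - f z := by linarith
  calc ‖x k ω - z‖ ^ 2 = 2 / lam1 * (lam1 / 2 * ‖x k ω - z‖ ^ 2) := by field_simp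
    _ ≤ _ := mul_le_mul_of_nonneg_left h2 (by positivity)
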